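/- Let $n,m_1,p_1$ be natural numbers. Let $A\in\mathbb R^{n\times n}$ be a Metzler matrix (that is, all its off-diagonal entries are nonnegative), let $B_1\in\mathbb R^{n\times m_1}$ and $C_1\in\mathbb R^{p_1\times n}$ be entrywise nonnegative, and let $\Delta\in\mathbb R^{m_1\times p_1}$ be entrywise nonnegative. Inequalities between matrices and vectors are understood entrywise, $\rho$ denotes the spectral radius, a real square matrix is called Hurwitz if every one of its (complex) eigenvalues has negative real part, and $\mathbf G_{11}(z)=C_1(zI-A)^{-1}B_1$. The following statements are equivalent. (i) Hypothesis (H1) holds: there exist $\xi>0$ and $p\in\mathbb R^{n}$ with all components strictly positive such that $p^\top(A+B_1\Delta C_1)\le-\xi p^\top$. (ii) $A+B_1\Sigma C_1$ is Hurwitz for every $\Sigma\in\mathbb R^{m_1\times p_1}$ with $0\le\Sigma\le\Delta$. (iii) $A$ is Hurwitz and $\rho(\mathbf G_{11}(0)\Delta)<1$. -/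

import Mathlib

open scoped Matrix

namespace PositiveLure

/-- A real square matrix is Metzler if all its off-diagonal entries are nonnegative. -/
def IsMetzler {n : ℕ} (M : Matrix (Fin n) (Fin n) ℝ) : Prop :=
  ∀ i j, i ≠ j → 0 ≤ M i j

/-- The entrywise order on real matrices. -/
def EntrywiseLE {m n : ℕ} (M N : Matrix (Fin m) (Fin n) ℝ) : Prop :=
  ∀ i j, M i j ≤ N i j

/-- A real matrix, viewed as a complex matrix. -/
def toComplex {m n : ℕ} (M : Matrix (Fin m) (Fin n) ℝ) : Matrix (Fin m) (Fin n) ℂ :=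
  M.map Complex.ofReal

/-- A real square matrix is Hurwitz if every complex eigenvalue of it has negative real part. -/
def IsHurwitz {n : ℕ} (M : Matrix (Fin n) (Fin n) ℝ) : Prop :=
  ∀ z : ℂ, Module.End.HasEigenvalue (Matrix.toLin' (toComplex M)) z → z.re < 0

/-- The transfer function `G(z) = C (z I - A)⁻¹ B`. -/
noncomputable def transferFunction {n m p : ℕ} (A : Matrix (Fin n) (Fin n) ℝ)
    (B : Matrix (Fin n) (Fin m) ℝ) (C : Matrix (Fin p) (Fin n) ℝ) (z : ℂ) :
    Matrix (Fin p) (Fin m) ℂ :=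
  toComplex C * (z • (1 : Matrix (Fin n) (Fin n) ℂ) - toComplex A)⁻¹ * toComplex B

/-- Hypothesis (H1): there are `ξ > 0` and a strictly positive vector `p` with
`pᵀ (A + B₁ Δ C₁) ≤ -ξ pᵀ` componentwise. -/
def HypothesisH1 {n m₁ p₁ : ℕ} (A : Matrix (Fin n) (Fin n) ℝ)
    (B₁ : Matrix (Fin n) (Fin m₁) ℝ) (C₁ : Matrix (Fin p₁) (Fin n) ℝ)
    (Δ : Matrix (Fin m₁) (Fin p₁) ℝ) : Prop :=
  ∃ ξ : ℝ, 0 < ξ ∧ ∃ p : Fin n → ℝ, (∀ i, 0 < p i) ∧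
    ∀ j, (p ᵥ* (A + B₁ * Δ * C₁)) j ≤ -ξ * p j

end PositiveLure

/-!
The proof rests on the classical theory of nonsingular M-matrices, in the following form. For a
Metzler matrix `M`, a vector `p > 0` with `pᵀ M < 0` makes `-M` inverse-monotone: `M x ≤ 0` forces
`x ≥ 0` (`IsMetzler.nonneg_of_mulVec_nonpos`). Such a certificate `p` implies that `M` is Hurwitz
(`IsMetzler.isHurwitz_of_vecMul_neg`, applying monotonicity to the moduli of an eigenvector).
Conversely, if `M` has no eigenvalue in `[0, ∞)`, then `(-M)⁻¹ ≥ 0`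
(`IsMetzler.inv_neg_nonneg_of_det_ne_zero`), and `pᵀ = 1ᵀ (-M)⁻¹` is a certificate. No part of
Perron–Frobenius theory is needed.

Let `K = A + B₁ Δ C₁` and `H = C₁ (-A)⁻¹ B₁ Δ`, which is the real matrix behind `G₁₁(0) Δ`.
* (i) ⇒ (ii): a certificate for `K` is one for each `A + B₁ Σ C₁`, as these are entrywise smaller.
* (ii) ⇒ (i): take `Σ = Δ`.
* (ii) ⇒ (iii): if `H` had an eigenvalue of modulus at least `1`, the moduli `u` of an eigenvector
  would satisfy `u ≤ H u`. Then `x = (-A)⁻¹ B₁ Δ u ≥ 0` satisfies `K x ≥ 0`, so `x = 0` by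
  monotonicity, and `u ≤ C₁ x = 0`.
* (iii) ⇒ (i): `H - I` is Metzler without eigenvalues in `[0, ∞)`, hence `(I - H)⁻¹ ≥ 0`, and the
  Woodbury formula `neg_mul_woodbury` exhibits `(-K)⁻¹` as a sum of products of nonnegative matrices.
-/

open Matrix

namespace PositiveLure

/-! ### Metzler matrices with a strictly decreasing positive functional -/

/-- Inverse-monotonicity of `-M`. If `x` were negative exactly on a nonempty set `S` of indices, the
sum of `p k * (M x) k` over `k ∈ S` would be positive, since each column contributes a nonnegative
amount, and the columns in `S` a positive one. -/
theorem IsMetzler.nonneg_of_mulVec_nonpos {n : ℕ} {M : Matrix (Fin n) (Fin n) ℝ}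
    (hM : IsMetzler M) {p : Fin n → ℝ} (hp : ∀ i, 0 < p i) (hpM : ∀ j, (p ᵥ* M) j < 0)
    {x : Fin n → ℝ} (hx : ∀ i, (M *ᵥ x) i ≤ 0) (i : Fin n) : 0 ≤ x i := by
  by_contra! hi
  set S := Finset.univ.filter fun k => x k < 0 with hS
  have h1 : ∑ k ∈ S, p k * (M *ᵥ x) k ≤ 0 :=
    Finset.sum_nonpos fun k _ => mul_nonpos_of_nonneg_of_nonpos (hp k).le (hx k)
  have h2 : ∑ k ∈ S, p k * (M *ᵥ x) k = ∑ j, x j * ∑ k ∈ S, p k * M k j := by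
    simp only [mulVec, dotProduct, Finset.mul_sum]
    rw [Finset.sum_comm]
    exact Finset.sum_congr rfl fun j _ => Finset.sum_congr rfl fun k _ => by ring
  have h3 : ∀ j, x j < 0 → 0 < x j * ∑ k ∈ S, p k * M k j := fun j hj => by
    refine mul_pos_of_neg_of_neg hj (lt_of_le_of_lt ?_ (hpM j))
    refine Finset.sum_le_sum_of_subset_of_nonneg (Finset.subset_univ _) fun k _ hk => ?_
    refine mul_nonneg (hp k).le (hM k j ?_)
    rintro rfl
    exact hk (by simpa [hS] using hj)
  have h4 : ∀ j, 0 ≤ x j * ∑ k ∈ S, p k * M k j := fun j => by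
    by_cases hj : x j < 0
    · exact (h3 j hj).le
    · refine mul_nonneg (not_lt.1 hj) (Finset.sum_nonneg fun k hk => ?_)
      refine mul_nonneg (hp k).le (hM k j ?_)
      rintro rfl
      exact hj (by simpa [hS] using hk)
  have h5 := Finset.sum_pos' (s := Finset.univ) (fun j _ => h4 j) ⟨i, Finset.mem_univ i, h3 i hi⟩
  linarith

theorem IsMetzler.inv_neg_nonneg {n : ℕ} {M : Matrix (Fin n) (Fin n) ℝ}
    (hM : IsMetzler M) {p : Fin n → ℝ} (hp : ∀ i, 0 < p i) (hpM : ∀ j, (p ᵥ* M) j < 0)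
    (hdet : IsUnit (-M).det) (i j : Fin n) : 0 ≤ (-M)⁻¹ i j := by
  refine hM.nonneg_of_mulVec_nonpos hp hpM (x := fun k => (-M)⁻¹ k j) (fun k => ?_) i
  have h : (-M * (-M)⁻¹) k j = (1 : Matrix (Fin n) (Fin n) ℝ) k j := by
    rw [mul_nonsing_inv _ hdet]
  rw [neg_mul, neg_apply, mul_apply] at h
  have h0 : 0 ≤ (1 : Matrix (Fin n) (Fin n) ℝ) k j := by
    rw [one_apply]; split_ifs <;> norm_num
  simp only [mulVec, dotProduct]
  linarith

/-- The column sums `pᵀ = 1ᵀ R` of a nonnegative inverse `R` of `-M` are a positive certificate. -/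
theorem exists_pos_vecMul_eq_neg_one {n : ℕ} {M R : Matrix (Fin n) (Fin n) ℝ}
    (hR : ∀ i j, 0 ≤ R i j) (h : -M * R = 1) :
    ∃ p : Fin n → ℝ, (∀ i, 0 < p i) ∧ ∀ j, (p ᵥ* M) j = -1 := by
  refine ⟨fun j => ∑ i, R i j, fun j => ?_, fun j => ?_⟩
  -- a vanishing column sum of the nonnegative `R` is a zero column, but `R` is invertible
  · refine (Finset.sum_nonneg fun i _ => hR i j).lt_of_ne' fun h0 => ?_
    have hz := (Finset.sum_eq_zero_iff_of_nonneg fun i _ => hR i j).1 h0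
    have h2 := congrFun (congrFun h j) j
    rw [mul_apply, Finset.sum_eq_zero fun i _ => by rw [hz i (Finset.mem_univ i), mul_zero],
      one_apply_eq] at h2
    exact zero_ne_one h2
  · have h1 : (fun j => ∑ i, R i j) = (1 : Fin n → ℝ) ᵥ* R := by
      ext j; simp [vecMul, dotProduct]
    have h2 : R * M = -1 := by
      rw [← mul_eq_one_comm.1 h, mul_neg, neg_neg]
    rw [h1, vecMul_vecMul, h2, vecMul_neg, vecMul_one]
    rfl

theorem IsMetzler.sub_smul_one {n : ℕ} {M : Matrix (Fin n) (Fin n) ℝ} (hM : IsMetzler M)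
    (s : ℝ) : IsMetzler (M - s • (1 : Matrix (Fin n) (Fin n) ℝ)) := fun i j hij => by
  simpa [one_apply_ne hij] using hM i j hij

theorem vecMul_sub_smul_one {n : ℕ} (M : Matrix (Fin n) (Fin n) ℝ) (p : Fin n → ℝ) (s : ℝ)
    (j : Fin n) :
    (p ᵥ* (M - s • (1 : Matrix (Fin n) (Fin n) ℝ))) j = (p ᵥ* M) j - s * p j := by
  simp [vecMul_sub, vecMul_smul]

/-- A Metzler matrix without eigenvalues in `[0, ∞)` satisfies `(-M)⁻¹ ≥ 0`. The set of shifts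
`s ≥ 0` with `(s I - M)⁻¹ ≥ 0` is closed, contains all large `s`, and each positive element has
smaller elements, because a certificate for `M - s I` persists under small changes of `s`; so its
infimum is `0`. -/
theorem IsMetzler.inv_neg_nonneg_of_det_ne_zero {n : ℕ} {M : Matrix (Fin n) (Fin n) ℝ}
    (hM : IsMetzler M)
    (hdet : ∀ s : ℝ, 0 ≤ s → (s • (1 : Matrix (Fin n) (Fin n) ℝ) - M).det ≠ 0) (i j : Fin n) :
    0 ≤ (-M)⁻¹ i j := by
  set F : ℝ → Matrix (Fin n) (Fin n) ℝ := fun s => (s • 1 - M)⁻¹ with hF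
  have key : ∀ (p : Fin n → ℝ) (s : ℝ), 0 ≤ s → (∀ i, 0 < p i) →
      (∀ j, (p ᵥ* M) j - s * p j < 0) → ∀ i j, 0 ≤ F s i j := by
    intro p s hs hp hpM i j
    have h := (hM.sub_smul_one s).inv_neg_nonneg hp
      (fun j => by rw [vecMul_sub_smul_one]; exact hpM j)
      (by rw [neg_sub]; exact (hdet s hs).isUnit) i j
    rwa [neg_sub] at h
  have hcont : ContinuousOn F (Set.Ici 0) := by
    have hc : Continuous fun s : ℝ => s • (1 : Matrix (Fin n) (Fin n) ℝ) - M := by fun_prop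
    have : F = fun s => (s • (1 : Matrix (Fin n) (Fin n) ℝ) - M).det⁻¹ •
        (s • (1 : Matrix (Fin n) (Fin n) ℝ) - M).adjugate := by
      ext1 s
      simp only [hF, inv_def, Ring.inverse_eq_inv']
    rw [this]
    exact (hc.matrix_det.continuousOn.inv₀ fun s hs => hdet s hs).smul
      hc.matrix_adjugate.continuousOn
  set T : Set ℝ := Set.Ici 0 ∩ F ⁻¹' {R | ∀ i j, 0 ≤ R i j} with hT
  have hclosed : IsClosed T := by
    refine hcont.preimage_isClosed_of_isClosed isClosed_Ici ?_
    simp only [Set.ofPred_forall]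
    exact isClosed_iInter fun i => isClosed_iInter fun j =>
      isClosed_le continuous_const (by fun_prop)
  have hne : T.Nonempty := by
    -- for a shift exceeding all column sums, the vector of ones is a certificate
    refine ⟨1 + ∑ j, ∑ i, |M i j|, ?_, key 1 _ ?_ (fun _ => one_pos) fun j => ?_⟩
    · exact Set.mem_Ici.2 (by positivity)
    · positivity
    · have h1 : ∑ i, M i j ≤ ∑ i, |M i j| := Finset.sum_le_sum fun i _ => le_abs_self _
      have h2 : ∑ i, |M i j| ≤ ∑ j, ∑ i, |M i j| :=
        Finset.single_le_sum (f := fun j => ∑ i, |M i j|)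
          (fun j _ => Finset.sum_nonneg fun i _ => abs_nonneg _) (Finset.mem_univ j)
      simp only [vecMul, dotProduct, Pi.one_apply, one_mul, mul_one]
      linarith
  have hbdd : BddBelow T := ⟨0, fun s hs => hs.1⟩
  obtain ⟨ha, haF⟩ := hclosed.csInf_mem hne hbdd
  set a := sInf T with haT
  suffices h0 : a = 0 by simpa [h0, hF] using haF i j
  by_contra hne0
  have hapos : 0 < a := lt_of_le_of_ne ha (Ne.symm hne0)
  -- the certificate at `a` persists at slightly smaller shifts
  obtain ⟨p, hp, hpM⟩ := exists_pos_vecMul_eq_neg_one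
    (M := M - a • (1 : Matrix (Fin n) (Fin n) ℝ)) haF
    (by rw [neg_sub]; exact mul_nonsing_inv _ (hdet a ha).isUnit)
  have hev : ∀ᶠ s in nhds a, 0 < s ∧ ∀ j, (p ᵥ* M) j - s * p j < 0 := by
    refine (lt_mem_nhds hapos).and (Filter.eventually_all.2 fun j => ?_)
    have hc : Continuous fun s : ℝ => (p ᵥ* M) j - s * p j := by fun_prop
    refine hc.continuousAt.eventually_lt continuousAt_const ?_
    rw [← vecMul_sub_smul_one, hpM j]
    norm_num
  obtain ⟨s, ⟨hs0, hs⟩, hsa⟩ :=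
    ((hev.filter_mono nhdsWithin_le_nhds).and (self_mem_nhdsWithin (s := Set.Iio a))).exists
  exact (not_le.2 hsa) (csInf_le hbdd ⟨hs0.le, key p s hs0.le hp hs⟩)

/-! ### Complex spectra of real matrices -/

theorem toComplex_mul {m n k : ℕ} (M : Matrix (Fin m) (Fin n) ℝ) (N : Matrix (Fin n) (Fin k) ℝ) :
    toComplex (M * N) = toComplex M * toComplex N :=
  Matrix.map_mul (f := Complex.ofRealHom)

theorem toComplex_one {n : ℕ} : toComplex (1 : Matrix (Fin n) (Fin n) ℝ) = 1 :=
  Matrix.map_one _ Complex.ofReal_zero Complex.ofReal_one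

theorem algebraMap_mem_spectrum_toComplex {n : ℕ} {M : Matrix (Fin n) (Fin n) ℝ} {s : ℝ}
    (h : (s • (1 : Matrix (Fin n) (Fin n) ℝ) - M).det = 0) :
    (s : ℂ) ∈ spectrum ℂ (toComplex M) := by
  rw [spectrum.mem_iff, isUnit_iff_isUnit_det]
  have : algebraMap ℂ (Matrix (Fin n) (Fin n) ℂ) s - toComplex M =
      Complex.ofRealHom.mapMatrix (s • (1 : Matrix (Fin n) (Fin n) ℝ) - M) := by
    ext i j
    by_cases hij : i = j
    · subst hij; simp [toComplex, algebraMap_matrix_apply]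
    · simp [toComplex, algebraMap_matrix_apply, hij]
  rw [this, ← RingHom.map_det, h]
  simp

theorem hasEigenvalue_toLin'_iff {n : ℕ} (M : Matrix (Fin n) (Fin n) ℂ) (z : ℂ) :
    Module.End.HasEigenvalue (toLin' M) z ↔ z ∈ spectrum ℂ M := by
  rw [Module.End.hasEigenvalue_iff_mem_spectrum, spectrum_toLin']

theorem exists_mulVec_eq_smul_of_mem_spectrum {n : ℕ} {M : Matrix (Fin n) (Fin n) ℂ} {z : ℂ}
    (h : z ∈ spectrum ℂ M) : ∃ v : Fin n → ℂ, v ≠ 0 ∧ M *ᵥ v = z • v := by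
  obtain ⟨v, hv⟩ := ((hasEigenvalue_toLin'_iff M z).2 h).exists_hasEigenvector
  exact ⟨v, hv.2, by simpa using hv.apply_eq_smul⟩

theorem IsHurwitz.det_ne_zero {n : ℕ} {M : Matrix (Fin n) (Fin n) ℝ} (hM : IsHurwitz M)
    (s : ℝ) (hs : 0 ≤ s) : (s • (1 : Matrix (Fin n) (Fin n) ℝ) - M).det ≠ 0 := fun h => by
  have := hM s ((hasEigenvalue_toLin'_iff _ _).2 (algebraMap_mem_spectrum_toComplex h))
  rw [Complex.ofReal_re] at this
  linarith

theorem IsHurwitz.isUnit_det_neg {n : ℕ} {M : Matrix (Fin n) (Fin n) ℝ} (hM : IsHurwitz M) :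
    IsUnit (-M).det := by
  simpa using (hM.det_ne_zero 0 le_rfl).isUnit

/-- If `M v = z v` with `0 ≤ re z`, the triangle inequality gives `0 ≤ M |v|`; monotonicity of `-M`
applied to `-|v|` then forces `v = 0`. -/
theorem IsMetzler.isHurwitz_of_vecMul_neg {n : ℕ} {M : Matrix (Fin n) (Fin n) ℝ}
    (hM : IsMetzler M) {p : Fin n → ℝ} (hp : ∀ i, 0 < p i) (hpM : ∀ j, (p ᵥ* M) j < 0) :
    IsHurwitz M := by
  intro z hz
  obtain ⟨v, hv0, hv⟩ :=
    exists_mulVec_eq_smul_of_mem_spectrum ((hasEigenvalue_toLin'_iff _ _).1 hz)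
  by_contra! hre
  have hrow : ∀ i, 0 ≤ ∑ j, M i j * ‖v j‖ := fun i => by
    have h1 : (z - M i i) * v i = ∑ j ∈ Finset.univ.erase i, (M i j : ℂ) * v j := by
      have := congrFun hv i
      simp only [mulVec, dotProduct, toComplex, map_apply, Pi.smul_apply, smul_eq_mul] at this
      rw [← Finset.add_sum_erase _ _ (Finset.mem_univ i)] at this
      linear_combination -this
    have h2 : ‖z - M i i‖ * ‖v i‖ ≤ ∑ j ∈ Finset.univ.erase i, M i j * ‖v j‖ := by
      rw [← norm_mul, h1]
      refine (norm_sum_le _ _).trans (Finset.sum_le_sum fun j hj => ?_)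
      rw [norm_mul, Complex.norm_real,
        Real.norm_of_nonneg (hM i j (Finset.ne_of_mem_erase hj).symm)]
    have h3 : -M i i ≤ ‖z - M i i‖ := by
      have := Complex.re_le_norm (z - M i i)
      rw [Complex.sub_re, Complex.ofReal_re] at this
      linarith
    rw [← Finset.add_sum_erase _ _ (Finset.mem_univ i)]
    nlinarith [mul_le_mul_of_nonneg_right h3 (norm_nonneg (v i))]
  refine hv0 (funext fun i => ?_)
  have := hM.nonneg_of_mulVec_nonpos hp hpM (x := fun j => -‖v j‖)
    (fun i => by simpa [mulVec, dotProduct] using hrow i) i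
  exact norm_le_zero_iff.1 (by linarith)

theorem transferFunction_zero {n m p : ℕ} {A : Matrix (Fin n) (Fin n) ℝ}
    (B : Matrix (Fin n) (Fin m) ℝ) (C : Matrix (Fin p) (Fin n) ℝ) (hA : IsUnit (-A).det) :
    transferFunction A B C 0 = toComplex (C * (-A)⁻¹ * B) := by
  have h : (-toComplex A)⁻¹ = toComplex (-A)⁻¹ := by
    refine inv_eq_right_inv ?_
    have : -toComplex A = toComplex (-A) := by ext; simp [toComplex]
    rw [this, ← toComplex_mul, mul_nonsing_inv _ hA, toComplex_one]
  rw [transferFunction, zero_smul, zero_sub, h, toComplex_mul, toComplex_mul]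

/-- A nonnegative matrix without nonzero nonnegative vectors `u ≤ H u` has its spectrum in the open
unit disc: the moduli of an eigenvector for `1 ≤ ‖z‖` would form such a `u`. -/
theorem norm_lt_one_of_mem_spectrum {n : ℕ} {H : Matrix (Fin n) (Fin n) ℝ}
    (hH : ∀ i j, 0 ≤ H i j)
    (hsub : ∀ u : Fin n → ℝ, (∀ i, 0 ≤ u i) → (∀ i, u i ≤ (H *ᵥ u) i) → u = 0)
    {z : ℂ} (hz : z ∈ spectrum ℂ (toComplex H)) : ‖z‖ < 1 := by
  obtain ⟨v, hv0, hv⟩ := exists_mulVec_eq_smul_of_mem_spectrum hz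
  by_contra! h1
  have hu := hsub (fun i => ‖v i‖) (fun i => norm_nonneg _) fun i => by
    calc ‖v i‖ ≤ ‖z‖ * ‖v i‖ := le_mul_of_one_le_left (norm_nonneg _) h1
      _ = ‖(toComplex H *ᵥ v) i‖ := by rw [hv, Pi.smul_apply, smul_eq_mul, norm_mul]
      _ = ‖∑ j, toComplex H i j * v j‖ := rfl
      _ ≤ ∑ j, ‖toComplex H i j * v j‖ := norm_sum_le _ _
      _ = (H *ᵥ fun i => ‖v i‖) i := Finset.sum_congr rfl fun j _ => by
          rw [norm_mul, toComplex, map_apply, Complex.norm_real, Real.norm_of_nonneg (hH i j)]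
  exact hv0 (funext fun i => norm_eq_zero.1 (congrFun hu i))

theorem spectralRadius_lt_one {n : ℕ} {H : Matrix (Fin n) (Fin n) ℂ}
    (h : ∀ z ∈ spectrum ℂ H, ‖z‖ < 1) : spectralRadius ℂ H < 1 := by
  have hfin : (spectrum ℂ H).Finite := Matrix.finite_spectrum H
  have : spectralRadius ℂ H = hfin.toFinset.sup fun z => (‖z‖₊ : ENNReal) := by
    simp [spectralRadius, Finset.sup_eq_iSup]
  rw [this, Finset.sup_lt_iff (by simp)]
  intro z hz
  exact_mod_cast h z (hfin.mem_toFinset.1 hz)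

/-- The Neumann inverse of a nonnegative matrix of spectral radius below `1`, obtained from the fact
that `H - 1` is Metzler and has no eigenvalue in `[0, ∞)`. -/
theorem inv_one_sub_nonneg {n : ℕ} {H : Matrix (Fin n) (Fin n) ℝ} (hH : ∀ i j, 0 ≤ H i j)
    (hρ : spectralRadius ℂ (toComplex H) < 1) :
    IsUnit (1 - H).det ∧ ∀ i j, 0 ≤ (1 - H)⁻¹ i j := by
  have hdet : ∀ s : ℝ, 0 ≤ s → (s • (1 : Matrix (Fin n) (Fin n) ℝ) - (H - 1)).det ≠ 0 := by
    intro s hs h0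
    have h1 : s • (1 : Matrix (Fin n) (Fin n) ℝ) - (H - 1) = (s + 1) • 1 - H := by
      rw [add_smul, one_smul]; abel
    rw [h1] at h0
    have h2 : (‖((s + 1 : ℝ) : ℂ)‖₊ : ENNReal) < 1 :=
      (le_iSup₂ (f := fun (k : ℂ) (_ : k ∈ spectrum ℂ (toComplex H)) => (‖k‖₊ : ENNReal)) _
        (algebraMap_mem_spectrum_toComplex h0)).trans_lt hρ
    have h3 : ‖((s + 1 : ℝ) : ℂ)‖ < 1 := by exact_mod_cast h2
    rw [Complex.norm_real, Real.norm_of_nonneg (by linarith)] at h3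
    linarith
  have hM : IsMetzler (H - 1) := fun i j hij => by
    simpa [one_apply_ne hij] using hH i j
  refine ⟨by simpa using (hdet 0 le_rfl).isUnit, fun i j => ?_⟩
  simpa using hM.inv_neg_nonneg_of_det_ne_zero hdet i j

/-! ### Closed-loop matrices -/

theorem mul_entries_nonneg {m n k : ℕ} {M : Matrix (Fin m) (Fin n) ℝ}
    {N : Matrix (Fin n) (Fin k) ℝ} (hM : ∀ i j, 0 ≤ M i j) (hN : ∀ i j, 0 ≤ N i j) (i : Fin m)
    (j : Fin k) : 0 ≤ (M * N) i j := by
  rw [mul_apply]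
  exact Finset.sum_nonneg fun l _ => mul_nonneg (hM i l) (hN l j)

theorem mulVec_entries_nonneg {m n : ℕ} {M : Matrix (Fin m) (Fin n) ℝ} {x : Fin n → ℝ}
    (hM : ∀ i j, 0 ≤ M i j) (hx : ∀ i, 0 ≤ x i) (i : Fin m) : 0 ≤ (M *ᵥ x) i := by
  rw [mulVec, dotProduct]
  exact Finset.sum_nonneg fun l _ => mul_nonneg (hM i l) (hx l)

theorem IsMetzler.add_nonneg {n : ℕ} {M N : Matrix (Fin n) (Fin n) ℝ} (hM : IsMetzler M)
    (hN : ∀ i j, 0 ≤ N i j) : IsMetzler (M + N) := fun i j hij =>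
  _root_.add_nonneg (hM i j hij) (hN i j)

theorem exists_vecMul_le_neg_mul {n : ℕ} {M : Matrix (Fin n) (Fin n) ℝ} {p : Fin n → ℝ}
    (hp : ∀ i, 0 < p i) (hpM : ∀ j, (p ᵥ* M) j = -1) :
    ∃ ξ : ℝ, 0 < ξ ∧ ∀ j, (p ᵥ* M) j ≤ -ξ * p j := by
  have hs : 0 ≤ ∑ i, p i := Finset.sum_nonneg fun i _ => (hp i).le
  -- this `ξ` satisfies `ξ * p j ≤ 1`, and the summand `1` covers the case `n = 0`
  refine ⟨(1 + ∑ i, p i)⁻¹, by positivity, fun j => ?_⟩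
  have hj : p j ≤ ∑ i, p i := Finset.single_le_sum (fun i _ => (hp i).le) (Finset.mem_univ j)
  have : (1 + ∑ i, p i)⁻¹ * p j ≤ 1 := by
    rw [inv_mul_le_one₀ (by positivity)]
    linarith
  rw [hpM j]
  linarith

/-- The Woodbury formula for the inverse of `-(A + E C)`, with `R = (-A)⁻¹` and
`Q = (1 - C R E)⁻¹`. -/
theorem neg_mul_woodbury {n p : ℕ} {A R : Matrix (Fin n) (Fin n) ℝ}
    {E : Matrix (Fin n) (Fin p) ℝ} {C : Matrix (Fin p) (Fin n) ℝ} {Q : Matrix (Fin p) (Fin p) ℝ}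
    (hR : -A * R = 1) (hQ : (1 - C * R * E) * Q = 1) :
    -(A + E * C) * (R + R * E * Q * C * R) = 1 := by
  have hA : A * R = -1 := by rw [← hR, neg_mul, neg_neg]
  have hQ' : C * R * E * Q = Q - 1 := by rw [sub_mul, one_mul] at hQ; rw [← hQ]; abel
  have h1 : A * (R * E * Q * C * R) = -(E * Q * C * R) := by
    simp only [← Matrix.mul_assoc, hA, Matrix.neg_mul, Matrix.one_mul]
  have h2 : E * C * (R * E * Q * C * R) = E * (C * R * E * Q) * C * R := by
    simp only [Matrix.mul_assoc]
  rw [neg_mul, add_mul, mul_add, mul_add, hA, h1, h2, hQ', Matrix.mul_sub, Matrix.mul_one,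
    Matrix.sub_mul, Matrix.sub_mul]
  abel

end PositiveLure

open PositiveLure in
theorem mainTheorem7 {n m₁ p₁ : ℕ}
    (A : Matrix (Fin n) (Fin n) ℝ) (B₁ : Matrix (Fin n) (Fin m₁) ℝ)
    (C₁ : Matrix (Fin p₁) (Fin n) ℝ) (Δ : Matrix (Fin m₁) (Fin p₁) ℝ)
    (hA : PositiveLure.IsMetzler A)
    (hB₁ : PositiveLure.EntrywiseLE 0 B₁) (hC₁ : PositiveLure.EntrywiseLE 0 C₁)
    (hΔ : PositiveLure.EntrywiseLE 0 Δ) :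
    List.TFAE [
      PositiveLure.HypothesisH1 A B₁ C₁ Δ,
      ∀ S : Matrix (Fin m₁) (Fin p₁) ℝ,
        PositiveLure.EntrywiseLE 0 S → PositiveLure.EntrywiseLE S Δ →
          PositiveLure.IsHurwitz (A + B₁ * S * C₁),
      PositiveLure.IsHurwitz A ∧
        spectralRadius ℂ
          (PositiveLure.transferFunction A B₁ C₁ 0 * PositiveLure.toComplex Δ) < 1] := by
  have hB : ∀ i j, 0 ≤ B₁ i j := hB₁
  have hC : ∀ i j, 0 ≤ C₁ i j := hC₁
  have hD : ∀ i j, 0 ≤ Δ i j := hΔ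
  have hBΔ := mul_entries_nonneg hB hD
  have hK : IsMetzler (A + B₁ * Δ * C₁) := hA.add_nonneg (mul_entries_nonneg hBΔ hC)
  tfae_have 1 → 2 := by
    rintro ⟨ξ, hξ, p, hp, hpK⟩ S hS0 hSΔ
    refine (hA.add_nonneg (mul_entries_nonneg (mul_entries_nonneg hB hS0)
      hC)).isHurwitz_of_vecMul_neg hp fun j => ?_
    have hle : (p ᵥ* (A + B₁ * S * C₁)) j ≤ (p ᵥ* (A + B₁ * Δ * C₁)) j := by
      simp only [vecMul, dotProduct, Matrix.add_apply, mul_apply]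
      gcongr with i _ k _ l _
      exacts [(hp i).le, hC k j, hB i l, hSΔ l k]
    have := mul_pos hξ (hp j)
    have := hpK j
    linarith
  tfae_have 2 → 1 := by
    intro h
    have hH := h Δ hΔ fun _ _ => le_rfl
    obtain ⟨p, hp, hpK⟩ := exists_pos_vecMul_eq_neg_one
      (hK.inv_neg_nonneg_of_det_ne_zero hH.det_ne_zero) (mul_nonsing_inv _ hH.isUnit_det_neg)
    obtain ⟨ξ, hξ, h⟩ := exists_vecMul_le_neg_mul hp hpK
    exact ⟨ξ, hξ, p, hp, h⟩
  tfae_have 2 → 3 := by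
    intro h
    have hAH : IsHurwitz A := by simpa using h 0 (fun _ _ => le_rfl) hΔ
    obtain ⟨ξ, hξ, p, hp, hpK⟩ := tfae_2_to_1 h
    have hR := hA.inv_neg_nonneg_of_det_ne_zero hAH.det_ne_zero
    refine ⟨hAH, ?_⟩
    rw [transferFunction_zero _ _ hAH.isUnit_det_neg, ← toComplex_mul]
    refine spectralRadius_lt_one fun z => norm_lt_one_of_mem_spectrum
      (mul_entries_nonneg (mul_entries_nonneg (mul_entries_nonneg hC hR) hB) hD)
      fun u hu0 hu => ?_
    set x := ((-A)⁻¹ * (B₁ * Δ)) *ᵥ u with hx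
    have hCx : (C₁ * (-A)⁻¹ * B₁ * Δ) *ᵥ u = C₁ *ᵥ x := by
      rw [hx, mulVec_mulVec]; simp only [Matrix.mul_assoc]
    have hAx : A *ᵥ x = -((B₁ * Δ) *ᵥ u) := by
      have : A * (-A)⁻¹ = -1 := by
        rw [← mul_nonsing_inv _ hAH.isUnit_det_neg, neg_mul, neg_neg]
      rw [hx, mulVec_mulVec, ← Matrix.mul_assoc, this, Matrix.neg_mul,
        Matrix.one_mul, neg_mulVec]
    have hx0 : ∀ i, 0 ≤ x i := mulVec_entries_nonneg (mul_entries_nonneg hR hBΔ) hu0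
    have hx1 : ∀ i, 0 ≤ -x i := by
      refine hK.nonneg_of_mulVec_nonpos hp (fun j => ?_) (x := fun i => -x i) fun i => ?_
      · have := mul_pos hξ (hp j)
        have := hpK j
        linarith
      -- `K x = B₁ Δ (C₁ x - u)` is nonnegative because `u ≤ H u = C₁ x`
      · have hd : (A + B₁ * Δ * C₁) *ᵥ x = (B₁ * Δ) *ᵥ (C₁ *ᵥ x - u) := by
          rw [add_mulVec, hAx, ← mulVec_mulVec x, mulVec_sub, neg_add_eq_sub]
        have := mulVec_entries_nonneg hBΔ (x := C₁ *ᵥ x - u)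
          (fun k => by rw [← hCx]; exact sub_nonneg.2 (hu k)) i
        change ((A + B₁ * Δ * C₁) *ᵥ (-x)) i ≤ 0
        rw [mulVec_neg, hd, Pi.neg_apply]
        linarith
    have hxz : x = 0 := funext fun i => le_antisymm (neg_nonneg.1 (hx1 i)) (hx0 i)
    rw [hCx, hxz, mulVec_zero] at hu
    exact funext fun i => le_antisymm (hu i) (hu0 i)
  tfae_have 3 → 1 := by
    rintro ⟨hAH, hρ⟩
    rw [transferFunction_zero _ _ hAH.isUnit_det_neg, ← toComplex_mul] at hρ
    have hR := hA.inv_neg_nonneg_of_det_ne_zero hAH.det_ne_zero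
    have hH := mul_entries_nonneg (mul_entries_nonneg (mul_entries_nonneg hC hR) hB) hD
    obtain ⟨hdet, hQ⟩ := inv_one_sub_nonneg hH hρ
    have hQ1 := mul_nonsing_inv _ hdet
    rw [Matrix.mul_assoc _ B₁ Δ] at hQ1 hQ
    have hW := neg_mul_woodbury (mul_nonsing_inv _ hAH.isUnit_det_neg) hQ1
    have hpos := mul_entries_nonneg (mul_entries_nonneg (mul_entries_nonneg
        (mul_entries_nonneg hR hBΔ) hQ) hC) hR
    obtain ⟨p, hp, hpK⟩ :=
      exists_pos_vecMul_eq_neg_one (fun i j => _root_.add_nonneg (hR i j) (hpos i j)) hW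
    obtain ⟨ξ, hξ, h⟩ := exists_vecMul_le_neg_mul hp hpK
    exact ⟨ξ, hξ, p, hp, h⟩
  tfae_finish
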